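/- Let $L$ be a frame with bottom $0$ and top $1$, and let $a^*$ denote the pseudocomplement of $a\in L$. Assume that $L$ is zero-dimensional: every $a\in L$ is the join of the elements $x\le a$ with $x\vee x^*=1$. Let $\mathcal{R}L$ be the commutative ring of frame homomorphisms $\alpha:\mathfrak{O}\mathbb{R}\to L$ from the frame of open sets of the real line, with $$(\alpha\diamond\beta)(U)=\bigvee\{\alpha(V)\wedge\beta(W) : V,W\in\mathfrak{O}\mathbb{R},\ x\diamond y\in U \text{ for all } x\in V,\ y\in W\}\qquad(\diamond\in\{+,\cdot\}),$$ and with constants $\mathbf{r}$ ($r\in\mathbb{R}$) given by $\mathbf{r}(U)=1$ if $r\in U$ and $\mathbf{r}(U)=0$ otherwise. Put $\operatorname{coz}\alpha=\alpha((-\infty,0))\vee\alpha((0,\infty))$ and $R_\alpha=\{r\in\mathbb{R} : \operatorname{coz}(\alpha-\mathbf{r})\neq 1\}$. Let $\mathcal{R}_cL$ be the subring of $\mathcal{R}L$ generated by the functions $\alpha$ for which $R_\alpha$ is countable (so $\mathcal{R}_cL=\{\alpha\in\mathcal{R}L : R_\alpha\text{ is countable}\}$ whenever this set is a subring), and let $\mathcal{R}_c^*L$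 be the subring of those $\alpha\in\mathcal{R}_cL$ that are bounded, i.e. satisfy $\alpha((p,q))=1$ for some real $p,q$. An ideal $Q$ of $\mathcal{R}_cL$ or of $\mathcal{R}_c^*L$ is called fixed if $\bigvee_{\alpha\in Q}\operatorname{coz}\alpha<1$. Then the following are equivalent: 1. $L$ is compact, i.e. every $T\subseteq L$ with $\bigvee T=1$ has a finite subset $S$ with $\bigvee S=1$; 2. every proper ideal of $\mathcal{R}_cL$ is fixed; 3. every maximal ideal of $\mathcal{R}_cL$ is fixed; 4. every proper ideal of $\mathcal{R}_c^*L$ is fixed; 5. every maximal ideal of $\mathcal{R}_c^*L$ is fixed. -/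

import Mathlib

open TopologicalSpace

namespace PointfreeReal

universe u

/-! ## Frames -/

section Frames

variable (L : Type u) [Order.Frame L]

/-- A frame is zero-dimensional if every element is the join of the complemented elements
below it. -/
def IsZeroDimensional : Prop :=
  ∀ a : L, a = sSup {x : L | x ⊔ xᶜ = ⊤ ∧ x ≤ a}

/-- A frame is compact if every cover of the top element has a finite subcover. -/
def IsCompactFrame : Prop :=
  ∀ T : Set L, sSup T = ⊤ → ∃ S : Set L, S ⊆ T ∧ S.Finite ∧ sSup S = ⊤

end Frames

/-! ## Pairing of frame homomorphisms out of the opens of a product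

If `X` is locally compact, the frame of opens of `X × Y` is the coproduct of the frames of opens
of `X` and `Y`. The pairing is used below with the operation `op` on `ℝ`, where it gives the usual
formula `(α op β)(U) = ⋁ {α(V) ∧ β(W) : V op W ⊆ U}`. -/

section Pairing

variable {X Y Z L : Type*} [TopologicalSpace X] [TopologicalSpace Y] [TopologicalSpace Z]
  [Order.Frame L]

/-- The open rectangle `V × W`. -/
def box (V : Opens X) (W : Opens Y) : Opens (X × Y) :=
  Opens.comap ContinuousMap.fst V ⊓ Opens.comap ContinuousMap.snd W

theorem mem_box {V : Opens X} {W : Opens Y} {p : X × Y} :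
    p ∈ box V W ↔ p.1 ∈ V ∧ p.2 ∈ W := Iff.rfl

/-- `U ↦ ⋁ {α(V) ∧ β(W) : V × W ⊆ U}`. -/
def pairFun (α : FrameHom (Opens X) L) (β : FrameHom (Opens Y) L) (U : Opens (X × Y)) : L :=
  ⨆ (V : Opens X) (W : Opens Y) (_ : box V W ≤ U), α V ⊓ β W

theorem le_pairFun (α : FrameHom (Opens X) L) (β : FrameHom (Opens Y) L) {U : Opens (X × Y)}
    {V : Opens X} {W : Opens Y} (h : box V W ≤ U) : α V ⊓ β W ≤ pairFun α β U :=
  le_iSup_of_le V <| le_iSup_of_le W <| le_iSup_of_le h le_rfl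

theorem pairFun_le (α : FrameHom (Opens X) L) (β : FrameHom (Opens Y) L) {U : Opens (X × Y)}
    {c : L} (h : ∀ V W, box V W ≤ U → α V ⊓ β W ≤ c) : pairFun α β U ≤ c :=
  iSup_le fun V => iSup_le fun W => iSup_le fun hVW => h V W hVW

theorem pairFun_mono (α : FrameHom (Opens X) L) (β : FrameHom (Opens Y) L)
    {U U' : Opens (X × Y)} (h : U ≤ U') : pairFun α β U ≤ pairFun α β U' :=
  pairFun_le α β fun _ _ hVW => le_pairFun α β (hVW.trans h)

theorem pairFun_inf (α : FrameHom (Opens X) L) (β : FrameHom (Opens Y) L)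
    (U U' : Opens (X × Y)) : pairFun α β (U ⊓ U') = pairFun α β U ⊓ pairFun α β U' := by
  apply le_antisymm
  · exact le_inf (pairFun_mono α β inf_le_left) (pairFun_mono α β inf_le_right)
  · rw [← le_himp_iff]
    refine pairFun_le α β fun V W hVW => ?_
    rw [le_himp_iff, inf_comm, ← le_himp_iff]
    refine pairFun_le α β fun V' W' hVW' => ?_
    rw [le_himp_iff]
    have h : box (V ⊓ V') (W ⊓ W') ≤ U ⊓ U' := fun p hp =>
      ⟨hVW ⟨hp.1.1, hp.2.1⟩, hVW' ⟨hp.1.2, hp.2.2⟩⟩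
    refine le_trans (le_of_eq ?_) (le_pairFun α β h)
    rw [map_inf, map_inf, inf_comm, inf_inf_inf_comm]

theorem pairFun_sSup [LocallyCompactSpace X] (α : FrameHom (Opens X) L)
    (β : FrameHom (Opens Y) L) (S : Set (Opens (X × Y))) :
    pairFun α β (sSup S) = sSup (pairFun α β '' S) := by
  apply le_antisymm
  · set c := sSup (pairFun α β '' S) with hc
    refine pairFun_le α β fun V W hVW => ?_
    -- compact part of the first factor, point of the second factor
    have tube : ∀ K : Set X, IsCompact K → K ⊆ V → ∀ y ∈ W,
        ∃ A : Opens X, K ⊆ A ∧ ∃ B : Opens Y, y ∈ B ∧ α A ⊓ β B ≤ c := by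
      intro K hK hKV y hy
      refine hK.induction_on (p := fun K => ∃ A : Opens X, K ⊆ A ∧
        ∃ B : Opens Y, y ∈ B ∧ α A ⊓ β B ≤ c) ?_ ?_ ?_ ?_
      · exact ⟨⊥, Set.empty_subset _, ⊤, trivial, by simp⟩
      · rintro s t hst ⟨A, hA, B, hB⟩
        exact ⟨A, hst.trans hA, B, hB⟩
      · rintro s t ⟨A, hA, B, hB, h⟩ ⟨A', hA', B', hB', h'⟩
        refine ⟨A ⊔ A', ?_, B ⊓ B', ⟨hB, hB'⟩, ?_⟩
        · rw [Opens.coe_sup]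
          exact Set.union_subset_union hA hA'
        · rw [map_sup, map_inf, inf_sup_right]
          exact sup_le ((inf_le_inf_left _ inf_le_left).trans h)
            ((inf_le_inf_left _ inf_le_right).trans h')
      · intro x hx
        have hxy : (x, y) ∈ sSup S := hVW ⟨hKV hx, hy⟩
        obtain ⟨U, hU, hxyU⟩ := Opens.mem_sSup.1 hxy
        obtain ⟨A, B, hA, hB, hxA, hyB, hAB⟩ := isOpen_prod_iff.1 U.isOpen x y hxyU
        refine ⟨A, mem_nhdsWithin_of_mem_nhds (hA.mem_nhds hxA), ⟨A, hA⟩, le_rfl, ⟨B, hB⟩, hyB,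
          ?_⟩
        exact (le_pairFun α β (U := U) fun p hp => hAB ⟨hp.1, hp.2⟩).trans
          (le_sSup ⟨U, hU, rfl⟩)
    have hV : V ≤ sSup {A : Opens X | α A ⊓ β W ≤ c} := by
      intro x hx
      obtain ⟨K, hK, hxK, hKV⟩ := exists_compact_subset V.isOpen hx
      refine Opens.mem_sSup.2 ⟨⟨interior K, isOpen_interior⟩, ?_, hxK⟩
      have hW : W ≤ sSup {B : Opens Y | α ⟨interior K, isOpen_interior⟩ ⊓ β B ≤ c} := by
        intro y hy
        obtain ⟨A, hKA, B, hyB, hAB⟩ := tube K hK hKV y hy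
        refine Opens.mem_sSup.2 ⟨B, ?_, hyB⟩
        refine le_trans (inf_le_inf_right _ (OrderHomClass.mono α ?_)) hAB
        exact interior_subset.trans hKA
      refine le_trans (inf_le_inf_left _ (OrderHomClass.mono β hW)) ?_
      rw [map_sSup, inf_comm, ← le_himp_iff]
      refine sSup_le ?_
      rintro _ ⟨B, hB, rfl⟩
      rw [le_himp_iff, inf_comm]
      exact hB
    refine le_trans (inf_le_inf_right _ (OrderHomClass.mono α hV)) ?_
    rw [map_sSup, ← le_himp_iff]
    refine sSup_le ?_
    rintro _ ⟨A, hA, rfl⟩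
    rw [le_himp_iff]
    exact hA
  · refine sSup_le ?_
    rintro _ ⟨U, hU, rfl⟩
    exact pairFun_mono α β (le_sSup hU)

/-- The frame homomorphism `𝒪(X × Y) → L` given by `U ↦ ⋁ {α(V) ∧ β(W) : V × W ⊆ U}`. -/
def pair [LocallyCompactSpace X] (α : FrameHom (Opens X) L) (β : FrameHom (Opens Y) L) :
    FrameHom (Opens (X × Y)) L where
  toFun := pairFun α β
  map_inf' := pairFun_inf α β
  map_top' := top_le_iff.1 <| by
    simpa using le_pairFun α β (le_top : box (⊤ : Opens X) (⊤ : Opens Y) ≤ ⊤)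
  map_sSup' := pairFun_sSup α β

/-- The image of a continuous map `f : Z → Y` under a frame homomorphism `φ : 𝒪 Z → L`. -/
def push (φ : FrameHom (Opens Z) L) (f : C(Z, Y)) : FrameHom (Opens Y) L :=
  φ.comp (Opens.comap f)

theorem pair_push [LocallyCompactSpace X] (φ : FrameHom (Opens Z) L) (f : C(Z, X))
    (g : C(Z, Y)) : pair (push φ f) (push φ g) = push φ (f.prodMk g) := by
  ext U
  apply le_antisymm
  · refine pairFun_le _ _ fun V W hVW => ?_
    change φ (Opens.comap f V) ⊓ φ (Opens.comap g W) ≤ φ (Opens.comap (f.prodMk g) U)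
    rw [← map_inf]
    exact OrderHomClass.mono φ fun z hz => hVW (show (f z, g z) ∈ box V W from hz)
  · have hU : Opens.comap (f.prodMk g) U ≤
        sSup {A : Opens Z | φ A ≤ pair (push φ f) (push φ g) U} := by
      intro z hz
      obtain ⟨V, W, hV, hW, hzV, hzW, hVW⟩ := isOpen_prod_iff.1 U.isOpen (f z) (g z) hz
      refine Opens.mem_sSup.2
        ⟨Opens.comap f ⟨V, hV⟩ ⊓ Opens.comap g ⟨W, hW⟩, ?_, hzV, hzW⟩
      change φ _ ≤ _
      rw [map_inf]
      exact le_pairFun (push φ f) (push φ g) (V := ⟨V, hV⟩) (W := ⟨W, hW⟩)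
        fun p hp => hVW ⟨hp.1, hp.2⟩
    refine (OrderHomClass.mono φ hU).trans ?_
    rw [map_sSup]
    refine sSup_le ?_
    rintro _ ⟨A, hA, rfl⟩
    exact hA

theorem push_fst_pair [LocallyCompactSpace X] (α : FrameHom (Opens X) L)
    (β : FrameHom (Opens Y) L) : push (pair α β) ContinuousMap.fst = α := by
  ext V
  apply le_antisymm
  · refine pairFun_le α β fun V' W hVW => ?_
    rcases (W : Set Y).eq_empty_or_nonempty with hW | ⟨y, hy⟩
    · have : W = ⊥ := Opens.ext hW
      simp [this]
    · exact inf_le_left.trans (OrderHomClass.mono α fun x hx =>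
        hVW (show (x, y) ∈ box V' W from ⟨hx, hy⟩))
  · have := le_pairFun α β (U := Opens.comap ContinuousMap.fst V) (V := V) (W := ⊤)
      inf_le_left
    rw [map_top, inf_top_eq] at this
    exact this

theorem push_snd_pair [LocallyCompactSpace X] (α : FrameHom (Opens X) L)
    (β : FrameHom (Opens Y) L) : push (pair α β) ContinuousMap.snd = β := by
  ext W
  apply le_antisymm
  · refine pairFun_le α β fun V W' hVW => ?_
    rcases (V : Set X).eq_empty_or_nonempty with hV | ⟨x, hx⟩
    · have : V = ⊥ := Opens.ext hV
      simp [this]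
    · exact inf_le_right.trans (OrderHomClass.mono β fun y hy =>
        hVW (show (x, y) ∈ box V W' from ⟨hx, hy⟩))
  · have := le_pairFun α β (U := Opens.comap ContinuousMap.snd W) (V := ⊤) (W := W)
      inf_le_right
    rw [map_top, top_inf_eq] at this
    exact this

end Pairing

/-! ## The ring `ℛL` -/

/-- The set `ℛL` of continuous real-valued functions on the frame `L`: frame homomorphisms from
the frame of opens of `ℝ` to `L`. -/
def R (L : Type u) [Order.Frame L] : Type u := FrameHom (Opens ℝ) L

section Ring

variable {L : Type u} [Order.Frame L]

instance : FunLike (R L) (Opens ℝ) L := inferInstanceAs (FunLike (FrameHom (Opens ℝ) L) _ _)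

instance : FrameHomClass (R L) (Opens ℝ) L :=
  inferInstanceAs (FrameHomClass (FrameHom (Opens ℝ) L) _ _)

/-- The constant function `𝐫`, sending `U` to `⊤` if `r ∈ U` and to `⊥` otherwise. -/
def const (r : ℝ) : R L where
  toFun U := ⨆ _ : r ∈ U, ⊤
  map_inf' U V := by
    by_cases hU : r ∈ U <;> by_cases hV : r ∈ V <;> simp [hU, hV]
  map_top' := by simp
  map_sSup' S := by
    rw [sSup_image]
    simp only [Opens.mem_sSup, iSup_exists, iSup_and]

/-- The value of a continuous real function on `X` at a frame homomorphism `𝒪 X → L`. -/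
def app {X : Type*} [TopologicalSpace X] (φ : FrameHom (Opens X) L) (f : C(X, ℝ)) : R L :=
  push φ f

instance : Zero (R L) := ⟨const 0⟩
instance : One (R L) := ⟨const 1⟩
/-- `(α + β)(U) = ⋁ {α(V) ∧ β(W) : V + W ⊆ U}`. -/
instance : Add (R L) :=
  ⟨fun α β => app (pair α β) ⟨fun p : ℝ × ℝ => p.1 + p.2, by fun_prop⟩⟩
/-- `(α β)(U) = ⋁ {α(V) ∧ β(W) : V W ⊆ U}`. -/
instance : Mul (R L) :=
  ⟨fun α β => app (pair α β) ⟨fun p : ℝ × ℝ => p.1 * p.2, by fun_prop⟩⟩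
/-- `(-α)(U) = α(-U)`. -/
instance : Neg (R L) := ⟨fun α => app α ⟨fun x : ℝ => -x, by fun_prop⟩⟩

section App

variable {X : Type*} [TopologicalSpace X] (φ : FrameHom (Opens X) L)

theorem app_add (f g : C(X, ℝ)) : app φ f + app φ g = app φ (f + g) :=
  congrArg (fun ψ => app ψ (⟨fun p : ℝ × ℝ => p.1 + p.2, by fun_prop⟩ : C(ℝ × ℝ, ℝ)))
    (pair_push φ f g)

theorem app_mul (f g : C(X, ℝ)) : app φ f * app φ g = app φ (f * g) :=
  congrArg (fun ψ => app ψ (⟨fun p : ℝ × ℝ => p.1 * p.2, by fun_prop⟩ : C(ℝ × ℝ, ℝ)))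
    (pair_push φ f g)

theorem app_neg (f : C(X, ℝ)) : -app φ f = app φ (-f) := rfl

theorem app_const (r : ℝ) : app φ (ContinuousMap.const X r) = const r := by
  apply FrameHom.ext
  intro U
  change φ (Opens.comap (ContinuousMap.const X r) U) = ⨆ _ : r ∈ U, ⊤
  by_cases h : r ∈ U
  · have : Opens.comap (ContinuousMap.const X r) U = ⊤ := top_le_iff.1 fun x _ => h
    simp [this, h]
  · have : Opens.comap (ContinuousMap.const X r) U = ⊥ := le_bot_iff.1 fun x hx => h hx
    simp [this, h]

theorem app_zero : app φ 0 = 0 := app_const φ 0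

theorem app_one : app φ 1 = 1 := app_const φ 1

end App

theorem exists_app₁ (α : R L) :
    ∃ (φ : FrameHom (Opens ℝ) L) (f : C(ℝ, ℝ)), α = app φ f :=
  ⟨α, ContinuousMap.id ℝ, FrameHom.ext fun _ => rfl⟩

theorem exists_app₂ (α β : R L) :
    ∃ (φ : FrameHom (Opens (ℝ × ℝ)) L) (f g : C(ℝ × ℝ, ℝ)), α = app φ f ∧ β = app φ g :=
  ⟨pair α β, ContinuousMap.fst, ContinuousMap.snd,
    (push_fst_pair α β).symm, (push_snd_pair α β).symm⟩

theorem exists_app₃ (α β γ : R L) :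
    ∃ (φ : FrameHom (Opens (ℝ × ℝ × ℝ)) L) (f g h : C(ℝ × ℝ × ℝ, ℝ)),
      α = app φ f ∧ β = app φ g ∧ γ = app φ h := by
  obtain ⟨ψ, g, h, rfl, rfl⟩ := exists_app₂ β γ
  refine ⟨pair α ψ, ContinuousMap.fst, g.comp ContinuousMap.snd, h.comp ContinuousMap.snd,
    (push_fst_pair α ψ).symm, ?_, ?_⟩
  · exact (congrArg (fun χ => app χ g) (push_snd_pair α ψ)).symm
  · exact (congrArg (fun χ => app χ h) (push_snd_pair α ψ)).symm

instance : CommRing (R L) where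
  add_assoc α β γ := by
    obtain ⟨φ, f, g, h, rfl, rfl, rfl⟩ := exists_app₃ α β γ
    simp only [app_add, add_assoc]
  zero_add α := by
    obtain ⟨φ, f, rfl⟩ := exists_app₁ α
    rw [← app_zero φ, app_add, zero_add]
  add_zero α := by
    obtain ⟨φ, f, rfl⟩ := exists_app₁ α
    rw [← app_zero φ, app_add, add_zero]
  add_comm α β := by
    obtain ⟨φ, f, g, rfl, rfl⟩ := exists_app₂ α β
    simp only [app_add, add_comm]
  nsmul := nsmulRec
  zsmul := zsmulRec
  neg_add_cancel α := by
    obtain ⟨φ, f, rfl⟩ := exists_app₁ α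
    rw [app_neg, app_add, neg_add_cancel, app_zero]
  mul_assoc α β γ := by
    obtain ⟨φ, f, g, h, rfl, rfl, rfl⟩ := exists_app₃ α β γ
    simp only [app_mul, mul_assoc]
  mul_comm α β := by
    obtain ⟨φ, f, g, rfl, rfl⟩ := exists_app₂ α β
    simp only [app_mul, mul_comm]
  one_mul α := by
    obtain ⟨φ, f, rfl⟩ := exists_app₁ α
    rw [← app_one φ, app_mul, one_mul]
  mul_one α := by
    obtain ⟨φ, f, rfl⟩ := exists_app₁ α
    rw [← app_one φ, app_mul, mul_one]
  zero_mul α := by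
    obtain ⟨φ, f, rfl⟩ := exists_app₁ α
    rw [← app_zero φ, app_mul, zero_mul]
  mul_zero α := by
    obtain ⟨φ, f, rfl⟩ := exists_app₁ α
    rw [← app_zero φ, app_mul, mul_zero]
  left_distrib α β γ := by
    obtain ⟨φ, f, g, h, rfl, rfl, rfl⟩ := exists_app₃ α β γ
    simp only [app_mul, app_add, mul_add]
  right_distrib α β γ := by
    obtain ⟨φ, f, g, h, rfl, rfl, rfl⟩ := exists_app₃ α β γ
    simp only [app_mul, app_add, add_mul]

/-- The cozero element `coz α = α(-,0) ∨ α(0,-)`. -/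
def coz (α : R L) : L := α ⟨Set.Iio 0, isOpen_Iio⟩ ⊔ α ⟨Set.Ioi 0, isOpen_Ioi⟩

/-- The pointfree image `R_α = {r ∈ ℝ | coz (α - 𝐫) ≠ 1}`. -/
def pfImage (α : R L) : Set ℝ := {r : ℝ | coz (α - const r) ≠ ⊤}

theorem pair_box_le (α β : R L) (V W : Opens ℝ) :
    α V ⊓ β W ≤ pair α β (box V W) :=
  le_pairFun α β le_rfl

theorem apply_pair_top {α β : R L} {V W U : Opens ℝ} (f : C(ℝ × ℝ, ℝ)) (hα : α V = ⊤)
    (hβ : β W = ⊤) (h : ∀ x ∈ V, ∀ y ∈ W, f (x, y) ∈ U) : app (pair α β) f U = ⊤ := by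
  have h1 := pair_box_le α β V W
  rw [hα, hβ, inf_top_eq, top_le_iff] at h1
  refine top_le_iff.1 (h1.symm.le.trans ?_)
  exact OrderHomClass.mono (pair α β) fun p hp => h p.1 hp.1 p.2 hp.2

/-- The open interval `(p, q)`. -/
def ioo (p q : ℝ) : Opens ℝ := ⟨Set.Ioo p q, isOpen_Ioo⟩

/-- `α ∈ ℛL` is bounded if `α(p, q) = 1` for some `p, q`. -/
def IsBdd (α : R L) : Prop := ∃ p q : ℝ, α (ioo p q) = ⊤

theorem IsBdd.exists_symm {α : R L} (h : IsBdd α) : ∃ M : ℝ, α (ioo (-M) M) = ⊤ := by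
  obtain ⟨p, q, h⟩ := h
  refine ⟨max (-p) q, top_le_iff.1 (h.symm.le.trans (OrderHomClass.mono α fun x hx => ?_))⟩
  exact ⟨by have := le_max_left (-p) q; have := hx.1; linarith,
    hx.2.trans_le (le_max_right _ _)⟩

theorem isBdd_const (r : ℝ) : IsBdd (const r : R L) :=
  ⟨r - 1, r + 1, by
    change (⨆ _ : r ∈ ioo (r - 1) (r + 1), (⊤ : L)) = ⊤
    have : r ∈ ioo (r - 1) (r + 1) := ⟨by linarith, by linarith⟩
    simp [this]⟩

variable (L)

/-- The bounded part `ℛ*L` of `ℛL`. -/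
def RStar : Subring (R L) where
  carrier := {α | IsBdd α}
  mul_mem' := by
    intro α β hα hβ
    obtain ⟨M, hM⟩ := IsBdd.exists_symm hα
    obtain ⟨N, hN⟩ := IsBdd.exists_symm hβ
    refine ⟨-(M * N), M * N, apply_pair_top _ hM hN fun x hx y hy => ?_⟩
    have hx' : |x| < M := abs_lt.2 hx
    have hy' : |y| < N := abs_lt.2 hy
    refine abs_lt.1 (show |x * y| < M * N from ?_)
    rw [abs_mul]
    exact mul_lt_mul'' hx' hy' (abs_nonneg _) (abs_nonneg _)
  one_mem' := isBdd_const 1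
  add_mem' := by
    intro α β hα hβ
    obtain ⟨p, q, h⟩ := hα
    obtain ⟨p', q', h'⟩ := hβ
    exact ⟨p + p', q + q', apply_pair_top _ h h' fun x hx y hy =>
      ⟨add_lt_add hx.1 hy.1, add_lt_add hx.2 hy.2⟩⟩
  zero_mem' := isBdd_const 0
  neg_mem' := by
    intro α hα
    obtain ⟨M, hM⟩ := IsBdd.exists_symm hα
    refine ⟨-M, M, top_le_iff.1 (hM.symm.le.trans (OrderHomClass.mono α fun x hx => ?_))⟩
    exact ⟨neg_lt_neg hx.2, by have := hx.1; show -x < M; linarith⟩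

/-- The functions with countable pointfree image. -/
def countableImage : Set (R L) := {α | (pfImage α).Countable}

/-- The ring `ℛ_c L`: the subring of `ℛL` formed by the functions with countable pointfree image.
For some frames the set of these functions is not closed under addition, so the subring that it
generates is taken; nothing is added whenever the set is a subring (`coe_Rc`). -/
def Rc : Subring (R L) := Subring.closure (countableImage L)

theorem coe_Rc (A : Subring (R L)) (hA : (A : Set (R L)) = countableImage L) :
    (Rc L : Set (R L)) = countableImage L := by
  rw [Rc, ← hA, Subring.closure_eq]

/-- The ring `ℛ_c^* L = ℛ_c L ∩ ℛ* L`. -/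
def RcStar : Subring (R L) := Rc L ⊓ RStar L

variable {L}

/-- An ideal `Q` of a subring of `ℛL` is fixed if `⋁ {coz α : α ∈ Q} < 1`. -/
def IsFixed {A : Subring (R L)} (Q : Ideal A) : Prop :=
  (⨆ α ∈ Q, coz (α : R L)) < ⊤

end Ring

end PointfreeReal

namespace PointfreeReal

open TopologicalSpace

universe v

/-! ### Cozero elements -/

section Coz

variable {L : Type v} [Order.Frame L]

/-! If `L` is compact and the cozero elements of an ideal join to `⊤`, then finitely many already
do. A sum of squares gives one member `β` of the ideal with `coz β = ⊤`. By compactness `β` is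
bounded away from `0`, so it has an inverse and the ideal is not proper.

The inverse must lie in the given subring, while `Rc L` is only generated by functions with
countable image, so `pfImage β` is not known in advance to be countable. This is settled by
evaluating at coatoms, which are points of `L`. Values at a fixed coatom respect the ring
operations, so every element of `Rc L` has countably many values (`countable_values_of_mem_Rc`). On
a compact frame every element other than `⊤` lies below a coatom, so the values make up the whole
image (`IsCompactFrame.pfImage_eq_values`). Compactness also makes every function bounded, which
handles `RcStar L`.

Conversely, a cover `T` without finite subcover yields a proper ideal: the functions whose cozero
element lies below a finite join from `T`. A maximal ideal above it contains the characteristic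
functions of all complemented elements below members of `T`. By zero-dimensionality these join to
`⊤`, so that maximal ideal is not fixed (`isCompactFrame_of_maximal_fixed`). -/

/-- The open set where a continuous real function does not vanish. -/
def nonzeroLocus {X : Type*} [TopologicalSpace X] (f : C(X, ℝ)) : Opens X :=
  ⟨{x | f x ≠ 0}, isOpen_ne_fun f.continuous continuous_const⟩

/-- Together with `exists_app₂`, this reduces inequalities between cozero elements to pointwise
facts about real functions. -/
theorem coz_app {X : Type*} [TopologicalSpace X] (φ : FrameHom (Opens X) L) (f : C(X, ℝ)) :
    coz (app φ f) = φ (nonzeroLocus f) := by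
  change φ _ ⊔ φ _ = _
  rw [← map_sup]
  congr 1
  ext x
  exact lt_or_lt_iff_ne (a := f x) (b := 0)

theorem coz_add_le (α β : R L) : coz (α + β) ≤ coz α ⊔ coz β := by
  obtain ⟨φ, f, g, rfl, rfl⟩ := exists_app₂ α β
  rw [app_add, coz_app, coz_app, coz_app, ← map_sup]
  refine OrderHomClass.mono φ fun x hx => ?_
  by_contra h
  have h' : ¬(f x ≠ 0 ∨ g x ≠ 0) := h
  push Not at h'
  exact hx (by simp [h'.1, h'.2])

theorem coz_mul_le_right (α β : R L) : coz (α * β) ≤ coz β := by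
  obtain ⟨φ, f, g, rfl, rfl⟩ := exists_app₂ α β
  rw [app_mul, coz_app, coz_app]
  exact OrderHomClass.mono φ fun x hx => right_ne_zero_of_mul hx

theorem sup_coz_le_coz_sq_add_sq (α β : R L) : coz α ⊔ coz β ≤ coz (α * α + β * β) := by
  obtain ⟨φ, f, g, rfl, rfl⟩ := exists_app₂ α β
  rw [app_mul, app_mul, app_add, coz_app, coz_app, coz_app, ← map_sup]
  refine OrderHomClass.mono φ fun x hx => ?_
  have hx' : f x ≠ 0 ∨ g x ≠ 0 := hx
  intro h
  have h' : f x * f x + g x * g x = 0 := h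
  have := mul_self_add_mul_self_eq_zero.1 h'
  tauto

theorem coz_zero : coz (0 : R L) = ⊥ := by
  change (⨆ _ : (0 : ℝ) ∈ Set.Iio (0 : ℝ), (⊤ : L)) ⊔ (⨆ _ : (0 : ℝ) ∈ Set.Ioi (0 : ℝ), ⊤) = ⊥
  simp

theorem coz_one : coz (1 : R L) = ⊤ := by
  change (⨆ _ : (1 : ℝ) ∈ Set.Iio (0 : ℝ), (⊤ : L)) ⊔ (⨆ _ : (1 : ℝ) ∈ Set.Ioi (0 : ℝ), ⊤) = ⊤
  simp

theorem app_sub_const {X : Type*} [TopologicalSpace X] (φ : FrameHom (Opens X) L)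
    (f : C(X, ℝ)) (r : ℝ) : app φ f - const r = app φ (f - ContinuousMap.const X r) := by
  rw [sub_eq_add_neg, ← app_const φ, app_neg, app_add, sub_eq_add_neg]

end Coz

/-! ### Characteristic functions; fixed maximal ideals force compactness -/

section Indicator

variable {L : Type v} [Order.Frame L]

/-- The frame homomorphism out of the opens of the two-point discrete space that sends
`{true}` to a complemented element `a`. -/
def boolHom (a : L) (ha : a ⊔ aᶜ = ⊤) : FrameHom (Opens Bool) L where
  toFun U := (⨆ _ : true ∈ U, a) ⊔ ⨆ _ : false ∈ U, aᶜ
  map_inf' U V := by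
    by_cases h1 : true ∈ U <;> by_cases h2 : true ∈ V <;> by_cases h3 : false ∈ U <;>
      by_cases h4 : false ∈ V <;> simp [h1, h2, h3, h4, ha]
  map_top' := by simp [ha]
  map_sSup' S := by
    rw [sSup_image]
    simp only [Opens.mem_sSup, iSup_exists, iSup_and, iSup_sup_eq]

/-- The characteristic function of a complemented element. -/
def indicator (a : L) (ha : a ⊔ aᶜ = ⊤) : R L :=
  app (boolHom a ha) ⟨fun b => if b then 1 else 0, continuous_of_discreteTopology⟩

theorem coz_indicator (a : L) (ha : a ⊔ aᶜ = ⊤) : coz (indicator a ha) = a := by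
  rw [indicator, coz_app]
  change (⨆ _ : _ ≠ _, a) ⊔ (⨆ _ : _ ≠ _, aᶜ) = a
  simp

theorem indicator_mem_countableImage (a : L) (ha : a ⊔ aᶜ = ⊤) :
    indicator a ha ∈ countableImage L := by
  refine Set.Countable.mono (s₂ := {0, 1}) (fun r hr => ?_) (Set.toFinite _).countable
  by_contra h
  simp only [Set.mem_insert_iff, Set.mem_singleton_iff, not_or] at h
  refine hr ?_
  rw [indicator, app_sub_const, coz_app]
  convert map_top (boolHom a ha)
  refine top_le_iff.1 fun b _ => ?_
  change (if b then (1 : ℝ) else 0) - r ≠ 0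
  cases b
  · simpa using h.1
  · simpa [sub_eq_zero] using Ne.symm h.2

theorem isBdd_indicator (a : L) (ha : a ⊔ aᶜ = ⊤) : IsBdd (indicator a ha) := by
  refine ⟨-1, 2, ?_⟩
  change boolHom a ha _ = ⊤
  convert map_top (boolHom a ha)
  refine top_le_iff.1 fun b _ => ?_
  change (if b then (1 : ℝ) else 0) ∈ Set.Ioo (-1 : ℝ) 2
  cases b <;> norm_num

/-- The ideal of functions whose cozero element lies below a finite join of elements of `T`. -/
def finiteCozIdeal (A : Subring (R L)) (T : Set L) : Ideal A where
  carrier := {α | ∃ S : Set L, S ⊆ T ∧ S.Finite ∧ coz (α : R L) ≤ sSup S}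
  zero_mem' := ⟨∅, Set.empty_subset _, Set.finite_empty, by simp [coz_zero]⟩
  add_mem' := by
    rintro α β ⟨S, hS, hSf, h⟩ ⟨S', hS', hSf', h'⟩
    refine ⟨S ∪ S', Set.union_subset hS hS', hSf.union hSf', ?_⟩
    rw [sSup_union]
    exact (coz_add_le _ _).trans (sup_le_sup h h')
  smul_mem' := by
    rintro α β ⟨S, hS, hSf, h⟩
    exact ⟨S, hS, hSf, (coz_mul_le_right _ _).trans h⟩

/-- The subring is arbitrary apart from containing the characteristic functions, so both `Rc L` and
`RcStar L` are covered. -/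
theorem isCompactFrame_of_maximal_fixed (hL : IsZeroDimensional L) (A : Subring (R L))
    (hA : ∀ a (ha : a ⊔ aᶜ = (⊤ : L)), indicator a ha ∈ A)
    (h : ∀ Q : Ideal A, Q.IsMaximal → IsFixed Q) : IsCompactFrame L := by
  intro T hT
  by_contra hS
  -- Since `coz 1 = ⊤`, having `1` in the ideal would give a finite subcover.
  have hI : finiteCozIdeal A T ≠ ⊤ := by
    intro htop
    obtain ⟨S, hST, hSf, hle⟩ := (Ideal.eq_top_iff_one _).1 htop
    exact hS ⟨S, hST, hSf, top_le_iff.1 (coz_one.symm.le.trans hle)⟩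
  obtain ⟨M, hM, hIM⟩ := Ideal.exists_le_maximal _ hI
  refine (h M hM).ne (top_le_iff.1 ?_)
  rw [← hT]
  refine sSup_le fun t ht => ?_
  rw [hL t]
  refine sSup_le ?_
  rintro a ⟨ha, hat⟩
  have hmem : (⟨indicator a ha, hA a ha⟩ : A) ∈ M :=
    hIM ⟨{t}, by simpa using ht, Set.finite_singleton t, by simpa [coz_indicator] using hat⟩
  refine le_trans (coz_indicator a ha).symm.le ?_
  exact le_iSup₂ (f := fun (α : A) (_ : α ∈ M) => coz (α : R L)) _ hmem

end Indicator

/-! ### Values of functions at coatoms -/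

section Values

variable {L : Type v} [Order.Frame L]

/-- By distributivity a coatom is prime, hence a point of the frame. -/
theorem le_or_le_of_inf_le_coatom {p x y : L} (hp : IsCoatom p) (h : x ⊓ y ≤ p) :
    x ≤ p ∨ y ≤ p := by
  by_contra! hxy
  have hx : p ⊔ x = ⊤ := hp.2 _ (left_lt_sup.2 hxy.1)
  refine hxy.2 ?_
  calc y = (p ⊔ x) ⊓ y := by rw [hx, top_inf_eq]
    _ = p ⊓ y ⊔ x ⊓ y := inf_sup_right _ _ _
    _ ≤ p := sup_le inf_le_left h

/-- `s` is the value of `α` at the point of `L` given by the prime element `p`. -/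
def IsValue {X : Type*} [TopologicalSpace X] (p : L) (α : FrameHom (Opens X) L) (s : X) : Prop :=
  ∀ U : Opens X, α U ≤ p ↔ s ∉ U

/-- Primeness makes the complement of the largest open set sent below `p` irreducible; in a
Hausdorff space it is then a single point, the value. -/
theorem exists_isValue {X : Type*} [TopologicalSpace X] [T2Space X] {p : L} (hp : IsCoatom p)
    (α : FrameHom (Opens X) L) : ∃ s, IsValue p α s := by
  set N : Opens X := sSup {U | α U ≤ p} with hN
  have hαN : α N ≤ p := by
    rw [hN, map_sSup]
    refine sSup_le ?_
    rintro _ ⟨U, hU, rfl⟩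
    exact hU
  have key : ∀ U : Opens X, α U ≤ p ↔ U ≤ N := fun U =>
    ⟨fun h => le_sSup h, fun h => (OrderHomClass.mono α h).trans hαN⟩
  have hpre : IsPreirreducible ((N : Set X)ᶜ) := by
    rintro u v hu hv ⟨x, hxN, hxu⟩ ⟨y, hyN, hyv⟩
    by_contra hne
    have hle : (⟨u, hu⟩ ⊓ ⟨v, hv⟩ : Opens X) ≤ N := fun z hz => by
      by_contra hzN
      exact hne ⟨z, hzN, hz⟩
    rw [← key, map_inf] at hle
    rcases le_or_le_of_inf_le_coatom hp hle with h | h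
    · exact hxN ((key _).1 h hxu)
    · exact hyN ((key _).1 h hyv)
  have hsub := isPreirreducible_iff_subsingleton.1 hpre
  have hne : ((N : Set X)ᶜ).Nonempty := by
    by_contra hemp
    rw [Set.not_nonempty_iff_eq_empty, Set.compl_empty_iff] at hemp
    have : (⊤ : Opens X) ≤ N := fun x _ => by rw [← SetLike.mem_coe, hemp]; trivial
    rw [← key, map_top] at this
    exact hp.1 (top_le_iff.1 this)
  obtain ⟨s, hs⟩ := hne
  refine ⟨s, fun U => ?_⟩
  rw [key]
  refine ⟨fun h hsU => hs (h hsU), fun h x hx => ?_⟩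
  by_contra hxN
  exact h (hsub hxN hs ▸ hx)

theorem IsValue.unique {X : Type*} [TopologicalSpace X] [T1Space X] {p : L}
    {α : FrameHom (Opens X) L} {s t : X} (hs : IsValue p α s) (ht : IsValue p α t) : s = t := by
  by_contra h
  have h1 := (hs ⟨{s}ᶜ, isOpen_compl_singleton⟩).2 (fun hx => hx rfl)
  exact (ht _).1 h1 (Ne.symm h)

theorem IsValue.push {X Y : Type*} [TopologicalSpace X] [TopologicalSpace Y] {p : L}
    {φ : FrameHom (Opens X) L} {x : X} (h : IsValue p φ x) (f : C(X, Y)) :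
    IsValue p (push φ f) (f x) := fun U => h (Opens.comap f U)

theorem isValue_pair {X Y : Type*} [TopologicalSpace X] [TopologicalSpace Y]
    [LocallyCompactSpace X] {p : L} (hp : IsCoatom p) {α : FrameHom (Opens X) L}
    {β : FrameHom (Opens Y) L} {s : X} {t : Y} (hs : IsValue p α s) (ht : IsValue p β t) :
    IsValue p (pair α β) (s, t) := by
  intro U
  constructor
  · intro h hst
    obtain ⟨V, W, hV, hW, hsV, htW, hVW⟩ := isOpen_prod_iff.1 U.isOpen s t hst
    have hle : α ⟨V, hV⟩ ⊓ β ⟨W, hW⟩ ≤ p :=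
      (le_pairFun α β (U := U) fun q hq => hVW ⟨hq.1, hq.2⟩).trans h
    rcases le_or_le_of_inf_le_coatom hp hle with h' | h'
    · exact (hs _).1 h' hsV
    · exact (ht _).1 h' htW
  · intro hst
    refine pairFun_le α β fun V W hVW => ?_
    by_cases hsV : s ∈ V
    · by_cases htW : t ∈ W
      · exact absurd (hVW (show (s, t) ∈ box V W from ⟨hsV, htW⟩)) hst
      · exact inf_le_right.trans ((ht W).2 htW)
    · exact inf_le_left.trans ((hs V).2 hsV)

theorem coz_sub_const_le_iff {p : L} {α : R L} {s : ℝ} (h : IsValue p α s) (r : ℝ) :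
    coz (α - const r) ≤ p ↔ s = r := by
  have hα : coz (α - const r) =
      α (nonzeroLocus (ContinuousMap.id ℝ - ContinuousMap.const ℝ r)) :=
    (congrArg coz (app_sub_const (L := L) α (ContinuousMap.id ℝ) r)).trans (coz_app α _)
  rw [hα]
  refine (h _).trans ?_
  change ¬ (s - r ≠ 0) ↔ _
  rw [not_not, sub_eq_zero]

/-- The set of values of `α` at the coatoms of `L`. -/
def values (α : R L) : Set ℝ := {s | ∃ p : L, IsCoatom p ∧ IsValue p α s}

/-- At each coatom both functions have a value, and the value of the combined function is computed
from these two. Taking `f` to be addition or multiplication covers the ring operations. -/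
theorem values_app_pair_subset (α β : R L) (f : C(ℝ × ℝ, ℝ)) :
    values (app (pair α β) f) ⊆ Set.image2 (fun x y => f (x, y)) (values α) (values β) := by
  rintro r ⟨p, hp, hr⟩
  obtain ⟨s, hs⟩ := exists_isValue hp α
  obtain ⟨t, ht⟩ := exists_isValue hp β
  exact ⟨s, ⟨p, hp, hs⟩, t, ⟨p, hp, ht⟩, ((isValue_pair hp hs ht).push f).unique hr⟩

theorem values_app_subset (α : R L) (f : C(ℝ, ℝ)) : values (app α f) ⊆ f '' values α := by
  rintro r ⟨p, hp, hr⟩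
  obtain ⟨s, hs⟩ := exists_isValue hp α
  exact ⟨s, ⟨p, hp, hs⟩, (hs.push f).unique hr⟩

theorem values_const_subset (r : ℝ) : values (const r : R L) ⊆ {r} := by
  rintro s ⟨p, hp, hs⟩
  by_contra h
  have h1 := (hs ⟨{s}ᶜ, isOpen_compl_singleton⟩).2 (fun hx => hx rfl)
  refine hp.1 (top_le_iff.1 (le_trans ?_ h1))
  exact le_iSup (fun _ : r ∈ ({s}ᶜ : Set ℝ) => (⊤ : L)) (Ne.symm h)

theorem values_subset_pfImage (α : R L) : values α ⊆ pfImage α := by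
  rintro s ⟨p, hp, hs⟩ htop
  exact hp.1 (top_le_iff.1 (htop ▸ (coz_sub_const_le_iff hs s).2 rfl))

end Values

/-! ### Compact frames: images, boundedness, inverses, fixed ideals -/

section Compact

variable {L : Type v} [Order.Frame L]

theorem IsCompactFrame.isCoatomic (hL : IsCompactFrame L) : IsCoatomic L := by
  refine CompleteLattice.coatomic_of_top_compact ?_
  rw [CompleteLattice.isCompactElement_iff_exists_le_sSup_of_le_sSup]
  intro T hT
  obtain ⟨S, hST, hSf, hS⟩ := hL T (top_le_iff.1 hT)
  refine ⟨hSf.toFinset, by simpa using hST, ?_⟩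
  rw [Finset.sup_id_eq_sSup, hSf.coe_toFinset, hS]

theorem IsCompactFrame.exists_eq_top (hL : IsCompactFrame L) {f : ℕ → L} (hf : Monotone f)
    (h : ⨆ n, f n = ⊤) : ∃ n, f n = ⊤ := by
  obtain ⟨S, hS, hSf, hStop⟩ := hL (Set.range f) h
  have key : ∃ n, sSup S ≤ f n := by
    clear hStop
    induction S, hSf using Set.Finite.induction_on with
    | empty => exact ⟨0, by simp⟩
    | @insert a S _ _ ih =>
      obtain ⟨n, hn⟩ := ih ((Set.subset_insert _ _).trans hS)
      obtain ⟨m, rfl⟩ := hS (Set.mem_insert _ _)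
      refine ⟨max m n, ?_⟩
      rw [sSup_insert]
      exact sup_le (hf (le_max_left _ _)) (hn.trans (hf (le_max_right _ _)))
  obtain ⟨n, hn⟩ := key
  exact ⟨n, top_le_iff.1 (hStop ▸ hn)⟩

/-- If `coz (α - const r) ≠ ⊤`, some coatom lies above it, and there the value of `α` is `r`. -/
theorem IsCompactFrame.pfImage_eq_values (hL : IsCompactFrame L) (α : R L) :
    pfImage α = values α := by
  refine Set.Subset.antisymm (fun r hr => ?_) (values_subset_pfImage α)
  have := hL.isCoatomic
  obtain ⟨p, hp, hle⟩ := (eq_top_or_exists_le_coatom (coz (α - const r))).resolve_left hr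
  obtain ⟨s, hs⟩ := exists_isValue hp α
  exact ⟨p, hp, (coz_sub_const_le_iff hs r).1 hle ▸ hs⟩

/-- Unlike countability of `pfImage`, countability of `values` passes through sums and products on
every frame. -/
theorem countable_values_of_mem_Rc {α : R L} (hα : α ∈ Rc L) : (values α).Countable := by
  induction hα using Subring.closure_induction with
  | mem α h => exact h.mono (values_subset_pfImage α)
  | zero => exact (Set.countable_singleton _).mono (values_const_subset 0)
  | one => exact (Set.countable_singleton _).mono (values_const_subset 1)
  | add α β _ _ hα hβ => exact (hα.image2 hβ _).mono (values_app_pair_subset α β _)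
  | neg α _ hα => exact (hα.image _).mono (values_app_subset α _)
  | mul α β _ _ hα hβ => exact (hα.image2 hβ _).mono (values_app_pair_subset α β _)

theorem IsCompactFrame.isBdd (hL : IsCompactFrame L) (α : R L) : IsBdd α := by
  obtain ⟨n, hn⟩ := hL.exists_eq_top (f := fun n : ℕ => α (ioo (-n) n))
    (fun m n hmn => OrderHomClass.mono α fun x hx => by
      have : (m : ℝ) ≤ n := Nat.cast_le.2 hmn
      exact ⟨by linarith [hx.1], by linarith [hx.2]⟩) (by
      rw [← map_iSup]
      convert map_top α
      refine top_le_iff.1 fun x _ => ?_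
      obtain ⟨n, hn⟩ := exists_nat_gt |x|
      exact Opens.mem_iSup.2 ⟨n, abs_lt.1 hn⟩)
  exact ⟨_, _, hn⟩

/-- A function on a compact frame with cozero element `⊤` is bounded away from `0`. -/
theorem IsCompactFrame.exists_pos_bound (hL : IsCompactFrame L) {β : R L} (h : coz β = ⊤) :
    ∃ δ : ℝ, 0 < δ ∧
      β ⟨{x : ℝ | δ < x ^ 2}, isOpen_lt continuous_const (by fun_prop)⟩ = ⊤ := by
  obtain ⟨n, hn⟩ := hL.exists_eq_top
    (f := fun n : ℕ => β ⟨{x : ℝ | 1 / ((n : ℝ) + 1) < x ^ 2},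
      isOpen_lt continuous_const (by fun_prop)⟩)
    (fun m n hmn => OrderHomClass.mono β fun x hx =>
      (Nat.one_div_le_one_div (α := ℝ) hmn).trans_lt (show 1 / ((m : ℝ) + 1) < x ^ 2 from hx)) (by
      rw [← map_iSup]
      refine top_le_iff.1 (h.symm.le.trans ?_)
      rw [coz, ← map_sup]
      refine OrderHomClass.mono β fun x hx => ?_
      have hx0 : x ≠ 0 := lt_or_lt_iff_ne.1 hx
      obtain ⟨n, hn⟩ := exists_nat_one_div_lt (pow_pos (abs_pos.2 hx0) 2)
      rw [sq_abs] at hn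
      exact Opens.mem_iSup.2 ⟨n, hn⟩)
  exact ⟨_, Nat.one_div_pos_of_nat, hn⟩

theorem IsCompactFrame.exists_mul_eq_one (hL : IsCompactFrame L) {β : R L} (hβ : β ∈ Rc L)
    (h : coz β = ⊤) : ∃ γ ∈ countableImage L, γ * β = 1 := by
  obtain ⟨δ, hδ, htop⟩ := hL.exists_pos_bound h
  have hpos : ∀ x : ℝ, max (x ^ 2) δ ≠ 0 := fun x => (lt_max_of_lt_right hδ).ne'
  -- A function continuous on all of `ℝ` that agrees with `1 / x` where `δ < x ^ 2`.
  let f : C(ℝ, ℝ) := ⟨fun x => x / max (x ^ 2) δ, by fun_prop (disch := exact hpos _)⟩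
  refine ⟨app β f, ?_, ?_⟩
  · change (pfImage _).Countable
    rw [hL.pfImage_eq_values]
    exact ((countable_values_of_mem_Rc hβ).image _).mono (values_app_subset β f)
  · have hid : β = app β (ContinuousMap.id ℝ) := FrameHom.ext fun _ => rfl
    have hmul : app β f * β = app β (f * ContinuousMap.id ℝ) := by
      conv_lhs => rw [hid]
      exact app_mul β f (ContinuousMap.id ℝ)
    rw [hmul, ← app_one β]
    refine FrameHom.ext fun U => ?_
    set D : Opens ℝ := ⟨{x : ℝ | δ < x ^ 2}, isOpen_lt continuous_const (by fun_prop)⟩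
    -- As `β D = ⊤`, only the behaviour on `D` matters, and there `f x * x = 1`.
    have hD : ∀ V : Opens ℝ, β V = β (V ⊓ D) := fun V => by rw [map_inf, htop, inf_top_eq]
    change β (Opens.comap _ U) = β (Opens.comap _ U)
    rw [hD, hD (Opens.comap 1 U)]
    congr 1
    ext x
    refine and_congr_left fun hx => ?_
    have hx' : δ < x ^ 2 := hx
    have h1 : x / max (x ^ 2) δ * x = 1 := by
      rw [max_eq_left hx'.le]
      rw [div_mul_eq_mul_div, ← sq, div_self (hδ.trans hx').ne']
    change x / max (x ^ 2) δ * x ∈ U ↔ (1 : ℝ) ∈ U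
    rw [h1]

theorem exists_mem_sSup_le_coz {A : Subring (R L)} (Q : Ideal A) {S : Set L} (hS : S.Finite)
    (h : ∀ a ∈ S, ∃ α ∈ Q, a ≤ coz (α : R L)) : ∃ β ∈ Q, sSup S ≤ coz (β : R L) := by
  induction S, hS using Set.Finite.induction_on with
  | empty => exact ⟨0, Q.zero_mem, by simp⟩
  | @insert a S _ _ ih =>
    obtain ⟨β, hβ, hle⟩ := ih fun b hb => h b (Set.mem_insert_of_mem _ hb)
    obtain ⟨α, hα, ha⟩ := h a (Set.mem_insert _ _)
    refine ⟨α * α + β * β, Q.add_mem (Q.mul_mem_left _ hα) (Q.mul_mem_left _ hβ), ?_⟩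
    rw [sSup_insert]
    exact (sup_le_sup ha hle).trans (sup_coz_le_coz_sq_add_sq _ _)

/-- The bound `A ≤ Rc L` makes a member of `Q` with cozero element `⊤` invertible; `countableImage L
⊆ A` puts the inverse back in `A`. -/
theorem IsCompactFrame.isFixed (hL : IsCompactFrame L) {A : Subring (R L)} (hA : A ≤ Rc L)
    (hA' : countableImage L ⊆ A) (Q : Ideal A) (hQ : Q ≠ ⊤) : IsFixed Q := by
  refine lt_top_iff_ne_top.2 fun htop => hQ ?_
  obtain ⟨S, hS, hSf, hStop⟩ := hL ((fun α : A => coz (α : R L)) '' Q)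
    (by rw [sSup_image]; exact htop)
  obtain ⟨β, hβ, hle⟩ := exists_mem_sSup_le_coz Q hSf fun a ha => by
    obtain ⟨α, hα, rfl⟩ := hS ha
    exact ⟨α, hα, le_rfl⟩
  obtain ⟨γ, hγ, hγβ⟩ := hL.exists_mul_eq_one (hA β.2) (top_le_iff.1 (hStop.symm.le.trans hle))
  rw [Ideal.eq_top_iff_one]
  convert Q.mul_mem_left ⟨γ, hA' hγ⟩ hβ
  exact Subtype.ext hγβ.symm

end Compact

end PointfreeReal

theorem theorem6p9 {L : Type*} [Order.Frame L] (hL : PointfreeReal.IsZeroDimensional L) :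
    List.TFAE
      [PointfreeReal.IsCompactFrame L,
        ∀ Q : Ideal (PointfreeReal.Rc L), Q ≠ ⊤ → PointfreeReal.IsFixed Q,
        ∀ Q : Ideal (PointfreeReal.Rc L), Q.IsMaximal → PointfreeReal.IsFixed Q,
        ∀ Q : Ideal (PointfreeReal.RcStar L), Q ≠ ⊤ → PointfreeReal.IsFixed Q,
        ∀ Q : Ideal (PointfreeReal.RcStar L), Q.IsMaximal → PointfreeReal.IsFixed Q] := by
  open PointfreeReal in
  tfae_have 1 → 2 := fun h => h.isFixed le_rfl Subring.subset_closure
  tfae_have 2 → 3 := fun h Q hQ => h Q hQ.ne_top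
  tfae_have 3 → 1 := isCompactFrame_of_maximal_fixed hL _ fun a ha =>
    Subring.subset_closure (indicator_mem_countableImage a ha)
  tfae_have 1 → 4 := fun h =>
    h.isFixed inf_le_left fun α hα => ⟨Subring.subset_closure hα, h.isBdd α⟩
  tfae_have 4 → 5 := fun h Q hQ => h Q hQ.ne_top
  tfae_have 5 → 1 := isCompactFrame_of_maximal_fixed hL _ fun a ha =>
    ⟨Subring.subset_closure (indicator_mem_countableImage a ha), isBdd_indicator a ha⟩
  tfae_finish
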